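/- Let $\mathbb{D}=\{z\in\mathbb{C}:|z|<1\}$, let $\mathbb{B}^n$ be the open unit ball of $\mathbb{R}^n$ with the Euclidean norm $|\cdot|$, and let $S^{n-1}=\partial\mathbb{B}^n$. Let $F:\mathbb{D}\to\mathbb{B}^n$ be a conformal minimal immersion, that is, a conformal immersion of class $C^2$ whose mean curvature vector vanishes identically. Let $z_0$ be a point with $|z_0|=1$ to which $F$ is extended by a value $F(z_0)\in S^{n-1}$, and suppose that the differential $dF(z_0)$ exists, that is, there is a real-linear map $dF(z_0):\mathbb{C}\to\mathbb{R}^n$ with $$F(z)=F(z_0)+dF(z_0)(z-z_0)+o(|z-z_0|)\qquad\text{as } z\to z_0,\ z\in\mathbb{D}.$$ Let $\|dF(z_0)\|$ be its operator norm. Then: (1) if $F(0)=0$, then $\|dF(z_0)\|\ge 1$; (2) in general, $\displaystyle \|dF(z_0)\|\ge\frac{1-|F(0)|}{1+|F(0)|}$. -/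

import Mathlib

open Metric Submodule
open scoped RealInnerProductSpace

noncomputable section

/-- The second fundamental form at `z` of an immersion `F` of (an open part of) the plane into
`ℝⁿ`: the component of `D²F(z)(u, v)` normal to the tangent plane `dF(z)(ℝ²)`. -/
def secondFundamentalForm {n : ℕ} (F : ℂ → EuclideanSpace ℝ (Fin n)) (z u v : ℂ) :
    EuclideanSpace ℝ (Fin n) :=
  ((fderiv ℝ F z).range)ᗮ.starProjection (fderiv ℝ (fderiv ℝ F) z u v)

/-- The matrix `g` of the first fundamental form (induced metric) at `z`, in the coordinates
`z = x + iy`; the basis is `(1, i)`. -/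
def firstFundamentalForm {n : ℕ} (F : ℂ → EuclideanSpace ℝ (Fin n)) (z : ℂ) :
    Matrix (Fin 2) (Fin 2) ℝ :=
  Matrix.of fun i j =>
    ⟪fderiv ℝ F z (Complex.basisOneI i), fderiv ℝ F z (Complex.basisOneI j)⟫

/-- The mean curvature vector at `z`: half the trace of the second fundamental form with respect
to the induced metric, `H = ½ ∑ gⁱʲ (∂ᵢ∂ⱼF)^⊥`. -/
def meanCurvatureVector {n : ℕ} (F : ℂ → EuclideanSpace ℝ (Fin n)) (z : ℂ) :
    EuclideanSpace ℝ (Fin n) :=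
  (1 / 2 : ℝ) • ∑ i, ∑ j, (firstFundamentalForm F z)⁻¹ i j •
    secondFundamentalForm F z (Complex.basisOneI i) (Complex.basisOneI j)

/-- `F` is a conformal minimal immersion of the open set `U ⊆ ℂ = ℝ²` into `ℝⁿ` (of class `C²`):
its differential is injective and angle preserving everywhere on `U`, and its mean curvature
vector vanishes identically there. -/
structure IsConformalMinimalImmersionOn {n : ℕ} (F : ℂ → EuclideanSpace ℝ (Fin n))
    (U : Set ℂ) : Prop where
  contDiffOn : ContDiffOn ℝ 2 F U
  immersion : ∀ z ∈ U, Function.Injective (fderiv ℝ F z)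
  conformal : ∀ z ∈ U, ConformalAt F z
  minimal : ∀ z ∈ U, meanCurvatureVector F z = 0

end

/-! In conformal coordinates minimality makes `F` harmonic, so everything rests on a Schwarz–Pick
estimate for conformal harmonic maps into the ball: at the centre, the radial derivative of `F` is
at most `‖F 0‖ * (1 - ‖F 0‖ ^ 2)` (`IsRealPartOnDisk.abs_inner_le`). That estimate is proved by
duality. The tangent plane through `F 0` cuts the ball in a round disk, whose Möbius parametrisation
is the extremal map. Multiplied by a suitable positive weight, its boundary values become a
trigonometric polynomial of degree one, so pairing it with `F` on circles involves only `F 0` and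
`dF(0)`, and Cauchy–Schwarz gives the bound. Disk automorphisms move the estimate to every point,
where it says that `‖F‖` grows along a radius no faster than the hyperbolic metric allows.
Integration gives a linear lower bound for `1 - ‖F‖`, and the differential at `z₀` inherits its
constant. -/

open Real in
/-- On the circle `|ζ| = r` the product of the harmonic function `Re h` with a linear function is
again the real part of a holomorphic function, which gives its average. -/
theorem circleAverage_re_mul_inner {h : ℂ → ℂ} (hh : DifferentiableOn ℂ h (ball 0 1))
    {r : ℝ} (hr0 : 0 < r) (hr1 : r < 1) (β : ℂ) :
    circleAverage (fun ζ => (h ζ).re * ⟪β, ζ⟫) 0 r = r ^ 2 / 2 * (deriv h 0 * β).re := by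
  have h0 : ball (0 : ℂ) 1 ∈ nhds (0 : ℂ) := ball_mem_nhds 0 one_pos
  have hk : DifferentiableOn ℂ (dslope h 0) (ball 0 1) := (Complex.differentiableOn_dslope h0).2 hh
  -- From `Re h * Re w = ½ Re (h w + h w̄)` with `w = β̄ζ`. On the circle `ζ * ζ̄ = r ^ 2` turns `h
  -- w̄` into `β h(0) ζ̄` plus a holomorphic term; conjugating the former keeps its real part.
  set P : ℂ → ℂ := fun ζ => (1 / 2) * (h ζ * ((starRingEnd ℂ) β * ζ)
    + (starRingEnd ℂ) (β * h 0) * ζ + (r : ℂ) ^ 2 * (β * dslope h 0 ζ)) with hP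
  have hPd : DifferentiableOn ℂ P (ball 0 1) := by
    rw [hP]; fun_prop
  have hsub : closedBall (0 : ℂ) |r| ⊆ ball 0 1 :=
    closedBall_subset_ball (by rwa [abs_of_pos hr0])
  have hPc : DiffContOnCl ℂ P (ball 0 |r|) := by
    apply DifferentiableOn.diffContOnCl
    exact hPd.mono (closure_ball_subset_closedBall.trans hsub)
  have hint : CircleIntegrable P 0 r := by
    apply ContinuousOn.circleIntegrable'
    exact hPd.continuousOn.mono (sphere_subset_closedBall.trans hsub)
  have h1 : circleAverage (Complex.reCLM ∘ P) 0 r = (P 0).re := by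
    rw [Complex.reCLM.circleAverage_comp_comm hint, hPc.circleAverage]
    rfl
  have h2 : circleAverage (fun ζ => (h ζ).re * ⟪β, ζ⟫) 0 r = circleAverage (Complex.reCLM ∘ P) 0 r := by
    apply circleAverage_congr_sphere
    intro ζ hζ
    have hζr : ζ * (starRingEnd ℂ) ζ = (r : ℂ) ^ 2 := by
      rw [Complex.mul_conj']
      simp only [mem_sphere_iff_norm, sub_zero] at hζ
      rw [hζ]; norm_cast; exact sq_abs r
    have hs : h ζ = h 0 + ζ * dslope h 0 ζ := by
      have := sub_smul_dslope h 0 ζ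
      simp only [sub_zero, smul_eq_mul] at this
      rw [this]; ring
    have hkey : (r : ℂ) ^ 2 * (β * dslope h 0 ζ)
        = β * (starRingEnd ℂ) ζ * h ζ - β * (starRingEnd ℂ) ζ * h 0 := by
      rw [← hζr, hs]; ring
    simp only [Function.comp, Complex.reCLM_apply, hP, hkey, Complex.inner]
    simp
    ring
  rw [h2, h1]
  simp [hP, ← Complex.ofReal_pow]
  ring

/-! ### Gradient estimate at the centre by duality. -/

section Duality

variable {V : Type*} [NormedAddCommGroup V] [InnerProductSpace ℝ V]

/-- All coordinates of `U` are real parts of holomorphic functions on the unit disk. -/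
structure IsRealPartOnDisk (U : ℂ → V) : Prop where
  continuousOn : ContinuousOn U (ball 0 1)
  exists_re : ∀ v : V, ∃ h : ℂ → ℂ, DifferentiableOn ℂ h (ball 0 1) ∧
    ∀ z ∈ ball (0 : ℂ) 1, ⟪U z, v⟫ = (h z).re

/-- Pairing with `⟪β, ·⟫` isolates the first Fourier mode on the circle, which for a harmonic map is
the differential at the centre. -/
theorem IsRealPartOnDisk.circleAverage_mul_inner {U : ℂ → V} (hU : IsRealPartOnDisk U)
    {D : ℂ →L[ℝ] V} (hD : HasFDerivAt U D 0) {r : ℝ} (hr0 : 0 < r) (hr1 : r < 1) (v : V) (β : ℂ) :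
    Real.circleAverage (fun ζ => ⟪U ζ, v⟫ * ⟪β, ζ⟫) 0 r = r ^ 2 / 2 * ⟪D β, v⟫ := by
  obtain ⟨h, hh, he⟩ := hU.exists_re v
  have h0 : ball (0 : ℂ) 1 ∈ nhds (0 : ℂ) := ball_mem_nhds 0 one_pos
  have e1 : Real.circleAverage (fun ζ => ⟪U ζ, v⟫ * ⟪β, ζ⟫) 0 r
      = Real.circleAverage (fun ζ => (h ζ).re * ⟪β, ζ⟫) 0 r := by
    apply Real.circleAverage_congr_sphere
    intro ζ hζ
    have : ζ ∈ ball (0 : ℂ) 1 := by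
      simp only [mem_sphere_iff_norm, sub_zero, abs_of_pos hr0] at hζ
      simpa [hζ] using hr1
    simp only [he ζ this]
  have hd1 : HasFDerivAt (fun z => (h z).re) (Complex.reCLM.comp (deriv h 0 • (1 : ℂ →L[ℝ] ℂ))) 0 :=
    Complex.reCLM.hasFDerivAt.comp 0 (hh.differentiableAt h0).hasDerivAt.complexToReal_fderiv
  have hd2 : HasFDerivAt (fun z => ⟪v, U z⟫) ((innerSL ℝ v).comp D) 0 :=
    (innerSL ℝ v).hasFDerivAt.comp 0 hD
  have hd3 : HasFDerivAt (fun z => (h z).re) ((innerSL ℝ v).comp D) 0 := by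
    apply hd2.congr_of_eventuallyEq
    filter_upwards [h0] with z hz
    rw [← he z hz, real_inner_comm]
  have := congrArg (fun T : ℂ →L[ℝ] ℝ => T β) (hd1.unique hd3)
  simp only [ContinuousLinearMap.comp_apply, innerSL_apply_apply, Complex.reCLM_apply,
    smul_apply, one_apply_eq_self, smul_eq_mul] at this
  rw [e1, circleAverage_re_mul_inner hh hr0 hr1, this, real_inner_comm]

theorem IsRealPartOnDisk.circleAverage_inner {U : ℂ → V} (hU : IsRealPartOnDisk U)
    {r : ℝ} (hr0 : 0 < r) (hr1 : r < 1) (v : V) :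
    Real.circleAverage (fun ζ => ⟪U ζ, v⟫) 0 r = ⟪U 0, v⟫ := by
  obtain ⟨h, hh, he⟩ := hU.exists_re v
  have hsub : closedBall (0 : ℂ) |r| ⊆ ball 0 1 :=
    closedBall_subset_ball (by rwa [abs_of_pos hr0])
  have hc : DiffContOnCl ℂ h (ball 0 |r|) :=
    DifferentiableOn.diffContOnCl (hh.mono (closure_ball_subset_closedBall.trans hsub))
  have hint : CircleIntegrable h 0 r :=
    ContinuousOn.circleIntegrable' (hh.continuousOn.mono (sphere_subset_closedBall.trans hsub))
  rw [he 0 (by simp), ← hc.circleAverage]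
  rw [← Complex.reCLM_apply, ← Complex.reCLM.circleAverage_comp_comm hint]
  apply Real.circleAverage_congr_sphere
  intro ζ hζ
  exact he ζ (hsub (sphere_subset_closedBall hζ))

/-- Averaging `⟪U, A + L⟫` over circles: a first-order test function that is dominated on the unit
circle by `c + ⟪β, ·⟫` bounds the corresponding combination of `U 0` and `dU(0)`. -/
theorem IsRealPartOnDisk.test_le {U : ℂ → V} (hU : IsRealPartOnDisk U)
    {D : ℂ →L[ℝ] V} (hD : HasFDerivAt U D 0) (hbound : ∀ z ∈ ball (0 : ℂ) 1, ‖U z‖ ≤ 1)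
    (A : V) (L : ℂ →L[ℝ] V) (c : ℝ) (β : ℂ)
    (hdom : ∀ ξ : ℂ, ‖ξ‖ = 1 → ‖A + L ξ‖ ≤ c + ⟪β, ξ⟫) :
    ⟪U 0, A⟫ + (⟪D 1, L 1⟫ + ⟪D Complex.I, L Complex.I⟫) / 2 ≤ c := by
  -- `U` has no boundary values, so the test function is evaluated at `ζ / r` on `|ζ| = r`, and then
  -- `r → 1`.
  have key : ∀ r ∈ Set.Ioo (0 : ℝ) 1,
      ⟪U 0, A⟫ + r * ((⟪D 1, L 1⟫ + ⟪D Complex.I, L Complex.I⟫) / 2) ≤ c := by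
    rintro r ⟨hr0, hr1⟩
    have hsub : sphere (0 : ℂ) |r| ⊆ ball 0 1 :=
      sphere_subset_ball (by rwa [abs_of_pos hr0])
    have hUc : ContinuousOn U (sphere (0 : ℂ) |r|) := hU.continuousOn.mono hsub
    have i1 : CircleIntegrable (fun ζ => ⟪U ζ, A⟫) 0 r :=
      ContinuousOn.circleIntegrable' (hUc.inner continuousOn_const)
    have i2 : ∀ (v : V) (γ : ℂ), CircleIntegrable (fun ζ => r⁻¹ * (⟪U ζ, v⟫ * ⟪γ, ζ⟫)) 0 r :=
      fun v γ => ContinuousOn.circleIntegrable' (continuousOn_const.mul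
        ((hUc.inner continuousOn_const).mul (continuousOn_const.inner continuousOn_id)))
    have i3 : CircleIntegrable (fun ζ => r⁻¹ * ⟪β, ζ⟫) 0 r :=
      ContinuousOn.circleIntegrable'
        (continuousOn_const.mul (continuousOn_const.inner continuousOn_id))
    have i4 : CircleIntegrable (fun _ : ℂ => c) 0 r :=
      ContinuousOn.circleIntegrable' continuousOn_const
    have av : ∀ (v : V) (γ : ℂ), Real.circleAverage (fun ζ => r⁻¹ * (⟪U ζ, v⟫ * ⟪γ, ζ⟫)) 0 r
        = r / 2 * ⟪D γ, v⟫ := by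
      intro v γ
      have := Real.circleAverage_fun_smul (a := r⁻¹) (f := fun ζ => ⟪U ζ, v⟫ * ⟪γ, ζ⟫)
        (c := 0) (R := r)
      simp only [smul_eq_mul] at this
      rw [this, hU.circleAverage_mul_inner hD hr0 hr1]
      field_simp
    have avβ : Real.circleAverage (fun ζ => r⁻¹ * ⟪β, ζ⟫) 0 r = 0 := by
      have := Real.circleAverage_fun_smul (a := r⁻¹) (f := fun ζ : ℂ => ⟪β, ζ⟫)
        (c := 0) (R := r)
      simp only [smul_eq_mul] at this
      rw [this]
      have := circleAverage_re_mul_inner (h := fun _ => 1) (differentiableOn_const _) hr0 hr1 β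
      simp only [Complex.one_re, one_mul, deriv_const, zero_mul, Complex.zero_re, mul_zero] at this
      rw [this, mul_zero]
    have hL : ∀ ζ : ℂ, L ζ = ζ.re • L 1 + ζ.im • L Complex.I := by
      intro ζ
      conv_lhs => rw [← Complex.re_add_im ζ]
      rw [map_add, ← map_smul, ← map_smul]
      simp
    have hle : Real.circleAverage (fun ζ => ⟪U ζ, A⟫ + (r⁻¹ * (⟪U ζ, L 1⟫ * ⟪(1 : ℂ), ζ⟫)
          + r⁻¹ * (⟪U ζ, L Complex.I⟫ * ⟪Complex.I, ζ⟫))) 0 r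
        ≤ Real.circleAverage (fun ζ => c + r⁻¹ * ⟪β, ζ⟫) 0 r := by
      apply Real.circleAverage_mono (i1.add ((i2 _ _).add (i2 _ _))) (i4.add i3)
      intro ζ hζ
      have hζ1 := hbound ζ (hsub hζ)
      simp only [mem_sphere_iff_norm, sub_zero, abs_of_pos hr0] at hζ
      have hn : ‖(r⁻¹ : ℝ) • ζ‖ = 1 := by
        rw [norm_smul, hζ, Real.norm_of_nonneg (by positivity)]
        field_simp
      have h1 := hdom _ hn
      rw [inner_smul_right] at h1
      calc _ = ⟪U ζ, A + L (r⁻¹ • ζ)⟫ := by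
            rw [map_smul, hL ζ, inner_add_right, inner_smul_right, inner_add_right,
              inner_smul_right, inner_smul_right]
            simp [Complex.inner]
            ring
        _ ≤ ‖U ζ‖ * ‖A + L (r⁻¹ • ζ)‖ := real_inner_le_norm _ _
        _ ≤ 1 * ‖A + L (r⁻¹ • ζ)‖ := by gcongr
        _ ≤ _ := by rw [one_mul]; exact h1
    have i5 : CircleIntegrable (fun ζ => r⁻¹ * (⟪U ζ, L 1⟫ * ⟪(1 : ℂ), ζ⟫)
        + r⁻¹ * (⟪U ζ, L Complex.I⟫ * ⟪Complex.I, ζ⟫)) 0 r := (i2 _ _).add (i2 _ _)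
    rw [Real.circleAverage_fun_add i1 i5,
      Real.circleAverage_fun_add (i2 _ _) (i2 _ _), av, av, hU.circleAverage_inner hr0 hr1,
      Real.circleAverage_fun_add i4 i3, avβ, Real.circleAverage_const] at hle
    linarith
  have hc : ContinuousWithinAt (fun r : ℝ =>
      ⟪U 0, A⟫ + r * ((⟪D 1, L 1⟫ + ⟪D Complex.I, L Complex.I⟫) / 2)) (Set.Ioo 0 1) 1 := by
    fun_prop
  have hcl : (1 : ℝ) ∈ closure (Set.Ioo (0 : ℝ) 1) := by
    rw [closure_Ioo (by norm_num)]; simp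
  have := hc.closure_le hcl continuousWithinAt_const key
  simpa using this

/-- Norm of the extremal test function on the unit circle. -/
theorem norm_extremal_eq (E : ℂ →ₗᵢ[ℝ] V) {e : V} (he : ∀ v, ⟪E v, e⟫ = 0) {ρ : ℝ}
    (hρ : ‖e‖ ^ 2 = 1 - ρ ^ 2) (b : ℂ) {ξ : ℂ} (hξ : ‖ξ‖ = 1) :
    ‖(1 + ‖b‖ ^ 2 + 2 * ⟪b, ξ⟫) • e + ρ • E (2 * b + ξ + b ^ 2 * (starRingEnd ℂ) ξ)‖
      = 1 + ‖b‖ ^ 2 + 2 * ⟪b, ξ⟫ := by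
  have hw : 1 + ‖b‖ ^ 2 + 2 * ⟪b, ξ⟫ = ‖ξ + b‖ ^ 2 := by
    rw [norm_add_sq_real, hξ, real_inner_comm]; ring
  have hξ2 : ξ * (starRingEnd ℂ) ξ = 1 := by
    rw [Complex.mul_conj', hξ]; simp
  have hn : ‖2 * b + ξ + b ^ 2 * (starRingEnd ℂ) ξ‖ = ‖ξ + b‖ ^ 2 := by
    have h1 : 2 * b + ξ + b ^ 2 * (starRingEnd ℂ) ξ = (ξ + b) ^ 2 * (starRingEnd ℂ) ξ := by
      linear_combination (- ξ - 2 * b) * hξ2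
    rw [h1, norm_mul, norm_pow, RCLike.norm_conj, hξ, mul_one]
  rw [hw, ← sq_eq_sq₀ (norm_nonneg _) (by positivity), norm_add_sq_real, inner_smul_left,
    inner_smul_right, real_inner_comm, he, norm_smul, norm_smul, E.norm_map, hn, mul_pow, mul_pow,
    hρ, Real.norm_eq_abs, Real.norm_eq_abs, sq_abs, sq_abs]
  simp
  ring

/-- Radial gradient estimate at the centre, for a harmonic map into the ball whose differential
at the centre is a positive multiple of an isometry. -/
theorem IsRealPartOnDisk.abs_inner_le {U : ℂ → V} (hU : IsRealPartOnDisk U)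
    (hbound : ∀ z ∈ ball (0 : ℂ) 1, ‖U z‖ < 1) {l : ℝ} (hl : 0 < l) (E : ℂ →ₗᵢ[ℝ] V)
    (hD : HasFDerivAt U (l • E.toContinuousLinearMap) 0) (v : ℂ) :
    |⟪l • E v, U 0⟫| ≤ ‖U 0‖ * (1 - ‖U 0‖ ^ 2) * ‖v‖ := by
  set q := U 0 with hq
  have hq1 : ‖q‖ < 1 := hbound 0 (by simp)
  -- `σ` is the adjoint of `E` applied to `q`, so `E σ` is the tangential part of `q` and `e` below
  -- its normal part.
  obtain ⟨σ, hσ⟩ : ∃ σ : ℂ, ∀ v, ⟪E v, q⟫ = ⟪v, σ⟫ := by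
    refine ⟨⟪E 1, q⟫ + ⟪E Complex.I, q⟫ * Complex.I, fun v => ?_⟩
    have : E v = v.re • E 1 + v.im • E Complex.I := by
      conv_lhs => rw [← Complex.re_add_im v]
      rw [map_add, ← map_smul, ← map_smul]
      simp
    rw [this, inner_add_left, inner_smul_left, inner_smul_left]
    simp [Complex.inner]
    ring
  set e := q - E σ with he
  have heE : ∀ v, ⟪E v, e⟫ = 0 := by
    intro v
    rw [he, inner_sub_right, hσ, E.inner_map_map, sub_self]
  have hqe : q = e + E σ := by rw [he]; abel
  have hnq : ‖q‖ ^ 2 = ‖e‖ ^ 2 + ‖σ‖ ^ 2 := by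
    rw [hqe, norm_add_sq_real, real_inner_comm, heE, E.norm_map]; ring
  have hq2 : ‖q‖ ^ 2 < 1 := by nlinarith [norm_nonneg q]
  have hpos : 0 < 1 - ‖e‖ ^ 2 := by nlinarith [norm_nonneg σ]
  -- The plane `q + E(ℂ)` meets the unit ball in a disk with centre `e` and radius `ρ`, in which `q`
  -- has normalised position `b`. The test function `A + L ξ` is `|1 + b̄ξ|²` times `e + ρ E((ξ + b)
  -- / (1 + b̄ξ))`.
  set ρ := Real.sqrt (1 - ‖e‖ ^ 2) with hρd
  have hρ0 : 0 < ρ := Real.sqrt_pos.2 hpos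
  have hρ : ρ ^ 2 = 1 - ‖e‖ ^ 2 := Real.sq_sqrt hpos.le
  obtain ⟨b, hb⟩ : ∃ b : ℂ, σ = ρ • b := ⟨ρ⁻¹ • σ, by rw [smul_inv_smul₀ hρ0.ne']⟩
  have hσb : ‖σ‖ = ρ * ‖b‖ := by rw [hb, norm_smul, Real.norm_of_nonneg hρ0.le]
  set L : ℂ →L[ℝ] V := ((2 : ℝ) • innerSL ℝ b).smulRight e
    + ρ • E.toContinuousLinearMap.comp
      (ContinuousLinearMap.id ℝ ℂ + (b ^ 2) • Complex.conjCLE.toContinuousLinearMap) with hL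
  have hLa : ∀ ξ, L ξ = (2 * ⟪b, ξ⟫) • e + ρ • E (ξ + b ^ 2 * (starRingEnd ℂ) ξ) := by
    intro ξ
    simp [hL]
  have htest := hU.test_le hD (fun z hz => (hbound z hz).le)
    ((1 + ‖b‖ ^ 2) • e + ρ • E (2 * b)) L (1 + ‖b‖ ^ 2) ((2 : ℝ) • b) (by
      intro ξ hξ
      have := norm_extremal_eq E heE (ρ := ρ) (by rw [hρ]; ring) b hξ
      rw [inner_smul_left]
      apply le_of_eq
      simp only [RCLike.conj_to_real]
      rw [← this, hLa]
      congr 1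
      simp only [map_add, smul_add, add_smul]
      abel)
  have hqA : ⟪q, (1 + ‖b‖ ^ 2) • e + ρ • E (2 * b)⟫
      = (1 + ‖b‖ ^ 2) * ‖e‖ ^ 2 + 2 * ρ ^ 2 * ‖b‖ ^ 2 := by
    have h2 : (2 : ℂ) * b = (2 : ℝ) • b := by simp
    rw [inner_add_right, inner_smul_right, inner_smul_right, real_inner_comm (E (2 * b)) q, hσ,
      h2, hb, inner_smul_left, inner_smul_right, real_inner_self_eq_norm_sq, hqe, inner_add_left,
      heE, real_inner_self_eq_norm_sq]
    simp only [RCLike.conj_to_real]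
    ring
  have hDL : ∀ ξ, ⟪(l • E.toContinuousLinearMap) ξ, L ξ⟫
      = l * ρ * ⟪ξ, ξ + b ^ 2 * (starRingEnd ℂ) ξ⟫ := by
    intro ξ
    rw [hLa, smul_apply, LinearIsometry.coe_toContinuousLinearMap,
      inner_smul_left, inner_add_right, inner_smul_right, heE, inner_smul_right, E.inner_map_map]
    simp only [RCLike.conj_to_real]
    ring
  have hsum : ⟪(1 : ℂ), 1 + b ^ 2 * (starRingEnd ℂ) 1⟫
      + ⟪Complex.I, Complex.I + b ^ 2 * (starRingEnd ℂ) Complex.I⟫ = 2 := by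
    simp [Complex.inner, pow_two]
    ring
  have hlρ : l * ρ ≤ 1 - ‖q‖ ^ 2 := by
    rw [← hq, hqA, hDL, hDL, ← mul_add, hsum] at htest
    rw [hnq, hσb]
    have : ρ * (l * ρ) ≤ ρ * (1 - (‖e‖ ^ 2 + (ρ * ‖b‖) ^ 2)) := by
      nlinarith [sq_nonneg ‖b‖]
    exact le_of_mul_le_mul_left this hρ0
  -- Equivalent to `‖σ‖ ^ 2 * (1 - ‖q‖ ^ 2) ≤ ‖q‖ ^ 2 * (1 - ‖q‖ ^ 2)`.
  have hσρ : ‖σ‖ ≤ ‖q‖ * ρ := by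
    rw [← sq_le_sq₀ (norm_nonneg _) (by positivity), mul_pow, hρ]
    have h1 : 1 - ‖e‖ ^ 2 = 1 - ‖q‖ ^ 2 + ‖σ‖ ^ 2 := by rw [hnq]; ring
    rw [h1]
    have h2 : ‖σ‖ ^ 2 ≤ ‖q‖ ^ 2 := by rw [hnq]; nlinarith [norm_nonneg e]
    nlinarith
  have hfin : l * ‖σ‖ ≤ ‖q‖ * (1 - ‖q‖ ^ 2) := by
    calc l * ‖σ‖ ≤ l * (‖q‖ * ρ) := by gcongr
      _ = ‖q‖ * (l * ρ) := by ring
      _ ≤ _ := by gcongr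
  rw [inner_smul_left, hσ]
  simp only [RCLike.conj_to_real]
  calc |l * ⟪v, σ⟫| = l * |⟪v, σ⟫| := by rw [abs_mul, abs_of_pos hl]
    _ ≤ l * (‖v‖ * ‖σ‖) := by gcongr; exact abs_real_inner_le_norm v σ
    _ = l * ‖σ‖ * ‖v‖ := by ring
    _ ≤ _ := by gcongr

end Duality

/-! ### Transport of the estimate by disk automorphisms. -/

section Moebius

/-- The automorphism `ζ ↦ (ζ + a) / (1 + āζ)` of the unit disk. -/
noncomputable def diskTranslation (a ζ : ℂ) : ℂ := (ζ + a) / (1 + (starRingEnd ℂ) a * ζ)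

variable {a ζ : ℂ}

theorem diskTranslation_denom_ne_zero (ha : ‖a‖ < 1) (hζ : ‖ζ‖ < 1) :
    1 + (starRingEnd ℂ) a * ζ ≠ 0 := by
  intro h
  have h1 : (starRingEnd ℂ) a * ζ = -1 := by linear_combination h
  have h2 : ‖a‖ * ‖ζ‖ = 1 := by
    have := congrArg norm h1
    simpa using this
  nlinarith [norm_nonneg a, norm_nonneg ζ]

theorem norm_diskTranslation_lt (ha : ‖a‖ < 1) (hζ : ‖ζ‖ < 1) : ‖diskTranslation a ζ‖ < 1 := by
  have hne := diskTranslation_denom_ne_zero ha hζ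
  rw [diskTranslation, norm_div, div_lt_one (norm_pos_iff.2 hne),
    ← sq_lt_sq₀ (norm_nonneg _) (norm_nonneg _)]
  have hd : ‖1 + (starRingEnd ℂ) a * ζ‖ ^ 2 - ‖ζ + a‖ ^ 2 = (1 - ‖a‖ ^ 2) * (1 - ‖ζ‖ ^ 2) := by
    simp only [Complex.sq_norm, Complex.normSq_apply]
    simp
    ring
  have : 0 < (1 - ‖a‖ ^ 2) * (1 - ‖ζ‖ ^ 2) :=
    mul_pos (by nlinarith [norm_nonneg a]) (by nlinarith [norm_nonneg ζ])
  linarith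

theorem hasDerivAt_diskTranslation_zero (a : ℂ) :
    HasDerivAt (diskTranslation a) ((1 - ‖a‖ ^ 2 : ℝ) : ℂ) 0 := by
  have h := ((hasDerivAt_id (0 : ℂ)).add_const a).fun_div
    (((hasDerivAt_id (0 : ℂ)).const_mul ((starRingEnd ℂ) a)).const_add 1) (by simp)
  refine h.congr_deriv ?_
  have := Complex.mul_conj' a
  simp [← this]

theorem differentiableOn_diskTranslation (ha : ‖a‖ < 1) :
    DifferentiableOn ℂ (diskTranslation a) (ball 0 1) := by
  unfold diskTranslation
  apply DifferentiableOn.fun_div (by fun_prop) (by fun_prop)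
  intro ζ hζ
  exact diskTranslation_denom_ne_zero ha (by simpa using hζ)

variable {V : Type*} [NormedAddCommGroup V] [InnerProductSpace ℝ V]

theorem IsRealPartOnDisk.comp_diskTranslation {U : ℂ → V} (hU : IsRealPartOnDisk U)
    (ha : ‖a‖ < 1) : IsRealPartOnDisk (U ∘ diskTranslation a) := by
  have hm : Set.MapsTo (diskTranslation a) (ball 0 1) (ball 0 1) := fun ζ hζ => by
    simpa using norm_diskTranslation_lt ha (by simpa using hζ)
  refine ⟨hU.continuousOn.comp (differentiableOn_diskTranslation ha).continuousOn hm, fun v => ?_⟩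
  obtain ⟨h, hh, he⟩ := hU.exists_re v
  exact ⟨h ∘ diskTranslation a, hh.comp (differentiableOn_diskTranslation ha) hm,
    fun z hz => he _ (hm hz)⟩

/-- Radial gradient estimate (a Schwarz–Pick lemma) at a point where `U` is conformal. -/
theorem IsRealPartOnDisk.abs_inner_fderiv_le {U : ℂ → V} (hU : IsRealPartOnDisk U)
    (hbound : ∀ z ∈ ball (0 : ℂ) 1, ‖U z‖ < 1) (ha : ‖a‖ < 1) (hd : DifferentiableAt ℝ U a)
    (hconf : ConformalAt U a) (v : ℂ) :
    (1 - ‖a‖ ^ 2) * |⟪fderiv ℝ U a v, U a⟫| ≤ ‖U a‖ * (1 - ‖U a‖ ^ 2) * ‖v‖ := by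
  have hda : (0 : ℝ) < 1 - ‖a‖ ^ 2 := by nlinarith [norm_nonneg a]
  obtain ⟨l, hl, E, hE⟩ : ∃ l : ℝ, 0 < l ∧ ∃ E : ℂ →ₗᵢ[ℝ] V,
      fderiv ℝ U a = l • E.toContinuousLinearMap := by
    obtain ⟨l, hl, E, hE⟩ := conformalAt_iff_isConformalMap_fderiv.1 hconf
    -- A negative factor is made positive by absorbing the sign into the isometry.
    rcases hl.lt_or_gt with h | h
    · refine ⟨-l, by linarith, E.comp (LinearIsometryEquiv.neg ℝ).toLinearIsometry, ?_⟩
      rw [hE]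
      ext v
      simp
    · exact ⟨l, h, E, hE⟩
  have h0 : diskTranslation a 0 = a := by simp [diskTranslation]
  have hD : HasFDerivAt (U ∘ diskTranslation a)
      (((1 - ‖a‖ ^ 2) * l) • E.toContinuousLinearMap) 0 := by
    have h1 := (hasDerivAt_diskTranslation_zero a).complexToReal_fderiv
    have h2 : HasFDerivAt U (fderiv ℝ U a) (diskTranslation a 0) := by
      rw [h0]; exact hd.hasFDerivAt
    refine (h2.comp 0 h1).congr_fderiv ?_
    rw [hE]
    ext1 v
    have : ((1 - ‖a‖ ^ 2 : ℝ) : ℂ) • v = (1 - ‖a‖ ^ 2 : ℝ) • v := by simp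
    simp only [ContinuousLinearMap.comp_apply, smul_apply, one_apply_eq_self, this, map_smul,
      LinearIsometry.coe_toContinuousLinearMap, mul_smul]
  have key := (hU.comp_diskTranslation ha).abs_inner_le (fun z hz => hbound _ (by
    simpa using norm_diskTranslation_lt ha (by simpa using hz))) (mul_pos hda hl) E hD v
  simp only [Function.comp_apply, h0] at key
  rw [hE]
  refine le_trans (le_of_eq ?_) key
  rw [mul_smul, inner_smul_left _ _ (1 - ‖a‖ ^ 2 : ℝ), abs_mul]
  simp only [RCLike.conj_to_real, abs_of_pos hda, smul_apply,
    LinearIsometry.coe_toContinuousLinearMap]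

end Moebius

/-! ### Conformal minimal immersions are harmonic. -/

theorem firstFundamentalForm_eq_smul_one {n : ℕ} {F : ℂ → EuclideanSpace ℝ (Fin n)} {z : ℂ} {c : ℝ}
    (hc : ∀ u v, ⟪fderiv ℝ F z u, fderiv ℝ F z v⟫ = c * ⟪u, v⟫) :
    firstFundamentalForm F z = c • (1 : Matrix (Fin 2) (Fin 2) ℝ) := by
  ext i j
  fin_cases i <;> fin_cases j <;> simp [firstFundamentalForm, hc, Complex.inner]

/-- In conformal coordinates a vanishing mean curvature vector means that `∂²F/∂x² + ∂²F/∂y²` is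
tangent. -/
theorem starProjection_laplacian_eq_zero {n : ℕ} {F : ℂ → EuclideanSpace ℝ (Fin n)} {z : ℂ}
    (hconf : ConformalAt F z) (hmin : meanCurvatureVector F z = 0) :
    ((fderiv ℝ F z).range)ᗮ.starProjection (fderiv ℝ (fderiv ℝ F) z 1 1
      + fderiv ℝ (fderiv ℝ F) z Complex.I Complex.I) = 0 := by
  obtain ⟨c, hc0, hc⟩ := conformalAt_iff'.1 hconf
  have hinv : (firstFundamentalForm F z)⁻¹ = c⁻¹ • (1 : Matrix (Fin 2) (Fin 2) ℝ) := by
    rw [firstFundamentalForm_eq_smul_one hc]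
    apply Matrix.inv_eq_right_inv
    rw [smul_mul_smul_comm, mul_inv_cancel₀ hc0.ne', one_mul, one_smul]
  rw [meanCurvatureVector, hinv] at hmin
  simp only [Fin.sum_univ_two, Matrix.smul_apply, Matrix.one_apply, secondFundamentalForm] at hmin
  simp [← smul_add, hc0.ne'] at hmin
  rw [map_add]
  simpa using hmin

/-- Minimality kills the normal part. The tangential part vanishes by conformality alone:
differentiate `⟪F_x, F_y⟫ = 0` and `‖F_x‖ ^ 2 = ‖F_y‖ ^ 2` and use the symmetry of second
derivatives. -/
theorem IsConformalMinimalImmersionOn.laplacian_eq_zero {n : ℕ}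
    {F : ℂ → EuclideanSpace ℝ (Fin n)} {U : Set ℂ} (hU : IsOpen U)
    (hF : IsConformalMinimalImmersionOn F U) {z : ℂ} (hz : z ∈ U) :
    fderiv ℝ (fderiv ℝ F) z 1 1 + fderiv ℝ (fderiv ℝ F) z Complex.I Complex.I = 0 := by
  have hUz : U ∈ nhds z := hU.mem_nhds hz
  have hcd : ContDiffAt ℝ 2 F z := hF.contDiffOn.contDiffAt hUz
  have hd : DifferentiableAt ℝ (fderiv ℝ F) z :=
    (hcd.fderiv_right (m := 1) (by norm_num)).differentiableAt (by norm_num)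
  have hsymm : ∀ u v, fderiv ℝ (fderiv ℝ F) z u v = fderiv ℝ (fderiv ℝ F) z v u :=
    hcd.isSymmSndFDerivAt (by simp)
  set S := fderiv ℝ (fderiv ℝ F) z with hS
  set D := fderiv ℝ F z with hD
  have hdir : ∀ u, HasFDerivAt (fun w => fderiv ℝ F w u) (S.flip u) z := fun u =>
    ((ContinuousLinearMap.apply ℝ (EuclideanSpace ℝ (Fin n)) u).hasFDerivAt).comp z hd.hasFDerivAt
  have e1 : ∀ w, ⟪S w Complex.I, D 1⟫ + ⟪D Complex.I, S w 1⟫ = 0 := by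
    intro w
    have h1 := (hdir Complex.I).inner ℝ (hdir 1)
    have h2 : HasFDerivAt (fun w => ⟪fderiv ℝ F w Complex.I, fderiv ℝ F w 1⟫)
        (0 : ℂ →L[ℝ] ℝ) z := by
      apply (hasFDerivAt_const (0 : ℝ) z).congr_of_eventuallyEq
      filter_upwards [hUz] with w hw
      obtain ⟨c, -, hc⟩ := conformalAt_iff'.1 (hF.conformal w hw)
      rw [hc]
      simp [Complex.inner]
    have := congrArg (fun T : ℂ →L[ℝ] ℝ => T w) (h1.unique h2)
    simpa [fderivInnerCLM_apply, add_comm] using this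
  have e2 : ∀ w, ⟪S w 1, D 1⟫ = ⟪S w Complex.I, D Complex.I⟫ := by
    intro w
    have h1 := ((hdir 1).inner ℝ (hdir 1)).sub ((hdir Complex.I).inner ℝ (hdir Complex.I))
    have h2 : HasFDerivAt ((fun w => ⟪fderiv ℝ F w 1, fderiv ℝ F w 1⟫)
        - (fun w => ⟪fderiv ℝ F w Complex.I, fderiv ℝ F w Complex.I⟫))
        (0 : ℂ →L[ℝ] ℝ) z := by
      apply (hasFDerivAt_const (0 : ℝ) z).congr_of_eventuallyEq
      filter_upwards [hUz] with w hw
      obtain ⟨c, -, hc⟩ := conformalAt_iff'.1 (hF.conformal w hw)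
      rw [Pi.sub_apply, hc, hc]
      simp
    have := congrArg (fun T : ℂ →L[ℝ] ℝ => T w) (h1.unique h2)
    simp only [sub_apply, ContinuousLinearMap.comp_apply, fderivInnerCLM_apply,
      ContinuousLinearMap.prod_apply, ContinuousLinearMap.flip_apply, zero_apply] at this
    rw [real_inner_comm (S w 1), real_inner_comm (S w Complex.I)] at this
    linarith
  have a1 := e1 1
  have a2 := e1 Complex.I
  have b1 := e2 1
  have b2 := e2 Complex.I
  rw [hsymm Complex.I 1] at a2 b2
  have t1 : ⟪D 1, S 1 1 + S Complex.I Complex.I⟫ = 0 := by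
    rw [inner_add_right, real_inner_comm, real_inner_comm (S Complex.I Complex.I)]
    rw [real_inner_comm] at a2
    rw [real_inner_comm] at a2
    linarith [real_inner_comm (D Complex.I) (S 1 Complex.I)]
  have t2 : ⟪D Complex.I, S 1 1 + S Complex.I Complex.I⟫ = 0 := by
    rw [inner_add_right]
    linarith [real_inner_comm (D Complex.I) (S Complex.I Complex.I)]
  have hperp : S 1 1 + S Complex.I Complex.I ∈ (D.range)ᗮ := by
    rw [Submodule.mem_orthogonal]
    rintro _ ⟨w, rfl⟩
    have : D w = w.re • D 1 + w.im • D Complex.I := by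
      conv_lhs => rw [← Complex.re_add_im w]
      rw [map_add, ← map_smul, ← map_smul]
      simp
    change ⟪D w, _⟫ = 0
    rw [this, inner_add_left, inner_smul_left, inner_smul_left, t1, t2]
    simp
  have h0 := starProjection_laplacian_eq_zero (hF.conformal z hz) (hF.minimal z hz)
  rwa [Submodule.starProjection_eq_self_iff.2 hperp] at h0

theorem IsConformalMinimalImmersionOn.isRealPartOnDisk {n : ℕ}
    {F : ℂ → EuclideanSpace ℝ (Fin n)} (hF : IsConformalMinimalImmersionOn F (ball 0 1)) :
    IsRealPartOnDisk F := by
  refine ⟨hF.contDiffOn.continuousOn, fun v => ?_⟩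
  have hharm : InnerProductSpace.HarmonicOnNhd F (ball 0 1) := by
    intro z hz
    refine ⟨hF.contDiffOn.contDiffAt (isOpen_ball.mem_nhds hz), ?_⟩
    filter_upwards [isOpen_ball.mem_nhds hz] with w hw
    rw [InnerProductSpace.laplacian_eq_iteratedFDeriv_complexPlane]
    simp only [iteratedFDeriv_two_apply]
    simpa using hF.laplacian_eq_zero isOpen_ball hw
  obtain ⟨h, hh, he⟩ := (hharm.comp_CLM (innerSL ℝ v)).exists_analyticOnNhd_ball_re_eq
  refine ⟨h, hh.differentiableOn, fun z hz => ?_⟩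
  have := he hz
  simp only [Function.comp_apply, innerSL_apply_apply] at this
  rw [this, real_inner_comm]

/-! ### Growth along a radius and the boundary differential. -/

/-- Comparison with the hyperbolic speed: integrating `g' / (1 - g²) ≤ 1 / (1 - t²)`, where the
inequality is only known at the positive values of `g`. -/
theorem le_one_sub_of_hyperbolic_speed {g g' : ℝ → ℝ} (hc : ContinuousOn g (Set.Ico 0 1))
    (h0 : ∀ t ∈ Set.Ico (0 : ℝ) 1, 0 ≤ g t) (h1 : ∀ t ∈ Set.Ico (0 : ℝ) 1, g t < 1)
    (hd : ∀ t ∈ Set.Ico (0 : ℝ) 1, 0 < g t → HasDerivAt g (g' t) t)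
    (hle : ∀ t ∈ Set.Ico (0 : ℝ) 1, 0 < g t → (1 - t ^ 2) * g' t ≤ 1 - g t ^ 2)
    {t : ℝ} (ht : t ∈ Set.Ico (0 : ℝ) 1) :
    (1 - g 0) / (1 + g 0) * (1 - t) ≤ 1 - g t := by
  have ha0 := h0 0 (by simp)
  have ha1 := h1 0 (by simp)
  obtain ⟨ht0, ht1⟩ := ht
  -- `T` is the last zero of `g` in `[0, t]`, or `0` if there is none; beyond it the differential
  -- inequality is available.
  obtain ⟨T, hT0, hTt, hpos, hT⟩ : ∃ T, 0 ≤ T ∧ T ≤ t ∧ (∀ s ∈ Set.Ioc T t, 0 < g s) ∧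
      (T = 0 ∨ g T = 0) := by
    by_cases hz : ∃ s ∈ Set.Icc 0 t, g s = 0
    · have hcI : ContinuousOn g (Set.Icc 0 t) :=
        hc.mono fun s hs => ⟨hs.1, hs.2.trans_lt ht1⟩
      have hK : IsCompact (Set.Icc 0 t ∩ g ⁻¹' {0}) :=
        isCompact_Icc.of_isClosed_subset
          (hcI.preimage_isClosed_of_isClosed isClosed_Icc isClosed_singleton)
          Set.inter_subset_left
      obtain ⟨s, hs, hs0⟩ := hz
      obtain ⟨T, hTm, hTg⟩ := hK.exists_isGreatest ⟨s, hs, hs0⟩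
      refine ⟨T, hTm.1.1, hTm.1.2, fun r hr => ?_, Or.inr hTm.2⟩
      have hr0 : 0 ≤ r := hTm.1.1.trans hr.1.le
      refine lt_of_le_of_ne (h0 r ⟨hr0, hr.2.trans_lt ht1⟩) fun h => ?_
      exact absurd (hTg ⟨⟨hr0, hr.2⟩, h.symm⟩) (not_le.2 hr.1)
    · push Not at hz
      exact ⟨0, le_rfl, ht0, fun s hs => lt_of_le_of_ne
        (h0 s ⟨hs.1.le, hs.2.trans_lt ht1⟩) (hz s ⟨hs.1.le, hs.2⟩).symm, Or.inl rfl⟩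
  -- `M = exp (2 (artanh g - artanh s))`, which the differential inequality makes nonincreasing.
  set M : ℝ → ℝ := fun s => (1 + g s) / (1 - g s) * ((1 - s) / (1 + s)) with hM
  have hanti : AntitoneOn M (Set.Icc T t) := by
    have hsub : ∀ s ∈ Set.Icc T t, s ∈ Set.Ico (0 : ℝ) 1 := fun s hs =>
      ⟨hT0.trans hs.1, hs.2.trans_lt ht1⟩
    have hder : ∀ s ∈ Set.Ioo T t, HasDerivAt M
        ((g' s * (1 - g s) - (1 + g s) * (-g' s)) / (1 - g s) ^ 2 * ((1 - s) / (1 + s))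
          + (1 + g s) / (1 - g s) * (((-1) * (1 + s) - (1 - s) * 1) / (1 + s) ^ 2)) s := by
      intro s hs
      have hs' := hsub s ⟨hs.1.le, hs.2.le⟩
      have hgs := hd s hs' (hpos s ⟨hs.1, hs.2.le⟩)
      have e1 : 1 - g s ≠ 0 := by linarith [h1 s hs']
      have e2 : 1 + s ≠ 0 := by linarith [hs'.1]
      exact ((hgs.const_add 1).fun_div (hgs.const_sub 1) e1).fun_mul
        (((hasDerivAt_id s).const_sub 1).fun_div ((hasDerivAt_id s).const_add 1) e2)
    apply antitoneOn_of_deriv_nonpos (convex_Icc T t)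
    · have hcI : ContinuousOn g (Set.Icc T t) := hc.mono hsub
      apply ContinuousOn.mul
      · exact (continuousOn_const.add hcI).div (continuousOn_const.sub hcI) fun s hs => by
          linarith [h1 s (hsub s hs)]
      · exact (continuousOn_const.sub continuousOn_id).div
          (continuousOn_const.add continuousOn_id) fun s hs => by
            have := (hsub s hs).1
            linarith
    · rw [interior_Icc]
      exact fun s hs => (hder s hs).differentiableAt.differentiableWithinAt
    · rw [interior_Icc]
      intro s hs
      rw [(hder s hs).deriv]
      have hs' := hsub s ⟨hs.1.le, hs.2.le⟩
      have e1 : 0 < 1 - g s := by linarith [h1 s hs']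
      have e2 : 0 < 1 + s := by linarith [hs'.1]
      have e3 := hle s hs' (hpos s ⟨hs.1, hs.2.le⟩)
      have : (g' s * (1 - g s) - (1 + g s) * (-g' s)) / (1 - g s) ^ 2 * ((1 - s) / (1 + s))
          + (1 + g s) / (1 - g s) * (((-1) * (1 + s) - (1 - s) * 1) / (1 + s) ^ 2)
          = 2 * ((1 - s ^ 2) * g' s - (1 - g s ^ 2)) / ((1 - g s) ^ 2 * (1 + s) ^ 2) := by
        field_simp
        ring
      rw [this]
      apply div_nonpos_of_nonpos_of_nonneg (by linarith) (by positivity)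
  have hMle : M t ≤ (1 + g 0) / (1 - g 0) := by
    refine (hanti ⟨le_rfl, hTt⟩ ⟨hTt, le_rfl⟩ hTt).trans ?_
    have hone : 1 ≤ (1 + g 0) / (1 - g 0) := by
      rw [le_div_iff₀ (by linarith)]; linarith
    rcases hT with rfl | hgT
    · simp [hM]
    · refine le_trans ?_ hone
      simp only [hM, hgT]
      rw [add_zero, sub_zero, div_one, one_mul, div_le_one (by linarith)]
      linarith
  have hgt := h1 t ⟨ht0, ht1⟩
  have hgt0 := h0 t ⟨ht0, ht1⟩
  rw [hM] at hMle
  simp only at hMle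
  rw [div_mul_div_comm, div_le_div_iff₀ (mul_pos (by linarith) (by linarith)) (by linarith)] at hMle
  rw [div_mul_eq_mul_div, div_le_iff₀ (by linarith)]
  -- Clearing denominators in `hMle` gives `(1 - g 0) * (1 - t) ≤ (1 + g 0 * t) * (1 - g t)`; this
  -- replaces `1 + g 0 * t` by `1 + g 0`.
  have h2 : g 0 * t * (1 - g t) ≤ g 0 * (1 - g t) := by
    apply mul_le_mul_of_nonneg_right _ (by linarith)
    nlinarith
  nlinarith

/-- The comparison is applied to `‖U (s • ω)‖`. Where this is positive, the factor `‖U‖` in the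
radial estimate cancels the denominator of the derivative of the norm. -/
theorem IsRealPartOnDisk.norm_le_along_radius {V : Type*} [NormedAddCommGroup V]
    [InnerProductSpace ℝ V] {U : ℂ → V} (hU : IsRealPartOnDisk U)
    (hbound : ∀ z ∈ ball (0 : ℂ) 1, ‖U z‖ < 1) (hd : ∀ z ∈ ball (0 : ℂ) 1, DifferentiableAt ℝ U z)
    (hconf : ∀ z ∈ ball (0 : ℂ) 1, ConformalAt U z) {ω : ℂ} (hω : ‖ω‖ = 1) {t : ℝ}
    (ht : t ∈ Set.Ico (0 : ℝ) 1) :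
    (1 - ‖U 0‖) / (1 + ‖U 0‖) * (1 - t) ≤ 1 - ‖U (t • ω)‖ := by
  have hn : ∀ s ∈ Set.Ico (0 : ℝ) 1, ‖s • ω‖ = s := fun s hs => by
    rw [norm_smul, hω, mul_one, Real.norm_of_nonneg hs.1]
  have hm : ∀ s ∈ Set.Ico (0 : ℝ) 1, s • ω ∈ ball (0 : ℂ) 1 := fun s hs => by
    rw [mem_ball_zero_iff, hn s hs]; exact hs.2
  have hder : ∀ s ∈ Set.Ico (0 : ℝ) 1, HasDerivAt (fun s : ℝ => U (s • ω))
      (fderiv ℝ U (s • ω) ω) s := fun s hs => by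
    have h1 : HasDerivAt (fun s : ℝ => s • ω) ω s := by
      simpa using (hasDerivAt_id s).smul_const ω
    exact (hd _ (hm s hs)).hasFDerivAt.comp_hasDerivAt s h1
  have key := le_one_sub_of_hyperbolic_speed (g := fun s => ‖U (s • ω)‖)
    (g' := fun s => ⟪U (s • ω), fderiv ℝ U (s • ω) ω⟫ / ‖U (s • ω)‖)
    (fun s hs => (hder s hs).continuousAt.norm.continuousWithinAt) (fun s _ => norm_nonneg _)
    (fun s hs => hbound _ (hm s hs)) ?_ ?_ ht
  · simpa using key
  · intro s hs hpos
    have h1 := (hder s hs).norm_sq.sqrt (by positivity)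
    simp only [Real.sqrt_sq (norm_nonneg _)] at h1
    refine h1.congr_deriv ?_
    rw [mul_div_mul_left _ _ two_ne_zero]
  · intro s hs hpos
    have h1 := hU.abs_inner_fderiv_le hbound (by simpa using hm s hs) (hd _ (hm s hs))
      (hconf _ (hm s hs)) ω
    rw [hn s hs, hω, mul_one, real_inner_comm] at h1
    have hs2 : 0 < 1 - s ^ 2 := by nlinarith [hs.1, hs.2]
    rw [← mul_div_assoc, div_le_iff₀ hpos]
    calc _ ≤ (1 - s ^ 2) * |⟪U (s • ω), fderiv ℝ U (s • ω) ω⟫| := by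
          gcongr; exact le_abs_self _
      _ ≤ _ := h1
      _ = _ := by ring

/-- A linear lower bound for `1 - ‖U‖` along a radius bounds the differential at its endpoint. -/
theorem le_opNorm_of_radial_bound {V : Type*} [NormedAddCommGroup V] [NormedSpace ℝ V]
    {U : ℂ → V} {ω : ℂ} (hω : ‖ω‖ = 1) (hUω : ‖U ω‖ = 1) {L : ℂ →L[ℝ] V}
    (hL : HasFDerivWithinAt U L (ball (0 : ℂ) 1) ω) {c : ℝ}
    (hc : ∀ t ∈ Set.Ico (0 : ℝ) 1, c * (1 - t) ≤ 1 - ‖U (t • ω)‖) : c ≤ ‖L‖ := by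
  refine le_of_forall_pos_le_add fun ε hε => ?_
  have h1 := hL.isLittleO.def hε
  have htend : Filter.Tendsto (fun t : ℝ => t • ω) (nhdsWithin 1 (Set.Ico 0 1))
      (nhdsWithin ω (ball 0 1)) := by
    apply tendsto_nhdsWithin_of_tendsto_nhds_of_eventually_within
    · have : Continuous fun t : ℝ => t • ω := by fun_prop
      have := this.tendsto 1
      rw [one_smul] at this
      exact this.mono_left nhdsWithin_le_nhds
    · filter_upwards [self_mem_nhdsWithin] with t ht
      rw [mem_ball_zero_iff, norm_smul, hω, mul_one, Real.norm_of_nonneg ht.1]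
      exact ht.2
  have hne : (nhdsWithin (1 : ℝ) (Set.Ico 0 1)).NeBot := by
    rw [← mem_closure_iff_nhdsWithin_neBot, closure_Ico (by norm_num)]
    simp
  obtain ⟨t, ht, htm⟩ := ((htend.eventually h1).and self_mem_nhdsWithin).exists
  have hpos : 0 < 1 - t := by linarith [htm.2]
  have hn : ‖t • ω - ω‖ = 1 - t := by
    rw [show t • ω - ω = (t - 1) • ω by rw [sub_smul, one_smul], norm_smul, hω, mul_one,
      Real.norm_of_nonpos (by linarith)]
    ring
  rw [hn] at ht
  have h2 := L.le_opNorm (t • ω - ω)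
  rw [hn] at h2
  have h3 : 1 - ‖U (t • ω)‖ ≤ ‖U (t • ω) - U ω‖ := by
    rw [← hUω, norm_sub_rev]; exact norm_sub_norm_le _ _
  have h4 : ‖U (t • ω) - U ω‖ ≤ ‖U (t • ω) - U ω - L (t • ω - ω)‖ + ‖L (t • ω - ω)‖ := by
    simpa using norm_add_le (U (t • ω) - U ω - L (t • ω - ω)) (L (t • ω - ω))
  have := hc t htm
  refine le_of_mul_le_mul_right ?_ hpos
  linarith

/-- `F` need only be given on the open unit disk and at `z₀`; `L` is the differential `dF(z₀)`,
taken from inside the disk, and `‖L‖` is its operator norm. -/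
theorem theorem1p3 (n : ℕ) (F : ℂ → EuclideanSpace ℝ (Fin n))
    (hF : IsConformalMinimalImmersionOn F (ball (0 : ℂ) 1))
    (hmaps : Set.MapsTo F (ball (0 : ℂ) 1) (ball (0 : EuclideanSpace ℝ (Fin n)) 1))
    (z₀ : ℂ) (hz₀ : ‖z₀‖ = 1) (hFz₀ : F z₀ ∈ sphere (0 : EuclideanSpace ℝ (Fin n)) 1)
    (L : ℂ →L[ℝ] EuclideanSpace ℝ (Fin n))
    (hL : HasFDerivWithinAt F L (ball (0 : ℂ) 1) z₀) :
    (F 0 = 0 → 1 ≤ ‖L‖) ∧ (1 - ‖F 0‖) / (1 + ‖F 0‖) ≤ ‖L‖ := by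
  have hd : ∀ z ∈ ball (0 : ℂ) 1, DifferentiableAt ℝ F z := fun z hz =>
    (hF.contDiffOn.contDiffAt (isOpen_ball.mem_nhds hz)).differentiableAt (by norm_num)
  have hmain : (1 - ‖F 0‖) / (1 + ‖F 0‖) ≤ ‖L‖ :=
    le_opNorm_of_radial_bound hz₀ (by simpa using hFz₀) hL fun t ht =>
      hF.isRealPartOnDisk.norm_le_along_radius (fun z hz => by simpa using hmaps hz) hd
        hF.conformal hz₀ ht
  refine ⟨fun h0 => ?_, hmain⟩
  simpa [h0] using hmain
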